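/- Network model. A network consists of $N\ge 1$ access points, $M\ge 1$ clients, an interval length $\tau\ge 1$ and success probabilities $p_{ij}\in[0,1]$ ($1\le i\le N$, $1\le j\le M$). Time is slotted and divided into consecutive intervals of $\tau$ slots. In every slot the channel from access point $i$ to client $j$ is good with probability $p_{ij}$, independently over all slots and all pairs $(i,j)$. In every interval each client requests one new packet. A scheduling policy $\eta$ assigns, right before each interval, every requested packet to one access point, and in each slot it chooses for each access point at most one packet to transmit among those assigned to it and not yet delivered in the current interval; all decisions are functions of the history (past assignments, transmissions and their outcomes). A transmission from $i$ to $j$ succeeds exactly when the channel from $i$ to $j$ is good in that slot; undelivered packets are dropped at the end of the interval. Let $N_j(k,\eta)\in\{0,1\}$ indicate whether client $j$ receives its packet in interval $k$. The total timely throughput $\mathsf T^3(\eta)$ is the largest $R$ such that with probability one $\limsup_{r\to\infty}\frac1r\sum_{k=1}^r\sum_{j=1}^M N_j(k,\eta)\ge R$, and $C_{\mathsf T^3}=\sup_\eta \mathsf T^3(\eta)$. Let $C_{\det}$ be the maximum of $\sum_{i,j}x_{ij}$ over $x_{ij}\in\{0,1\}$ subject to $\sum_{j}x_{ij}/p_{ij}\le\tau$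 for every $i$ (with $1/0=\infty$ and $0/0=0$) and $\sum_i x_{ij}\le 1$ for every $j$. Claim. (1) The upper bound $C_{\mathsf T^3}<C_{\det}+N$ is tight: for every $N\ge1$ and every real $0<\varepsilon<N$ there is a network with $N$ access points such that $C_{\mathsf T^3}-C_{\det}=N-\varepsilon$. (2) The lower bound $C_{\det}-2\sqrt{N(C_{\det}+N/4)}<C_{\mathsf T^3}$ is tight in order: there is an absolute constant $k>0$ such that for every $N\ge1$ and every integer $l\ge1$ there is a network with $N$ access points such that $C_{\det}=Nl$ and $C_{\det}-C_{\mathsf T^3}>k\sqrt{N\,C_{\det}}$. -/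

import Mathlib

open scoped ENNReal

/-- A downlink network with `N` access points: `M` clients, intervals of `τ` time-slots, and for each
access point `i` and client `j` the success probability `p i j` of the erasure channel from `i` to
`j` (`0` if there is no link). -/
structure Network (N : ℕ) where
  M : ℕ
  τ : ℕ
  M_pos : 0 < M
  τ_pos : 0 < τ
  p : Fin N → Fin M → unitInterval

/-- What happens in one time-slot: for each access point either nothing (`none`), or the client whose
packet it transmits together with the outcome of the transmission (`true` = delivered). -/
abbrev SlotRecord (N M : ℕ) : Type := Fin N → Option (Fin M × Bool)

/-- The events of one interval, up to some time-slot: the assignment of the requested packets (one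
per client) to the access points, and the elapsed time-slots in chronological order. -/
structure IntervalRecord (N M : ℕ) where
  assignment : Fin M → Fin N
  slots : List (SlotRecord N M)

/-- The packet of client `j` has been delivered in the recorded part of the interval. -/
def IntervalRecord.Delivered {N M : ℕ} (c : IntervalRecord N M) (j : Fin M) : Prop :=
  ∃ s ∈ c.slots, ∃ i, s i = some (j, true)

/-- A scheduling policy. Right before an interval starts, `assign` assigns every requested packet to
an access point, as a function of the history of all past intervals. In each time-slot, `transmit`
picks for every access point the packet that it transmits (or none), as a function of the history of
all past intervals and of the events so far in the current interval. An access point can only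
transmit a packet that is in its buffer: assigned to it, and not yet delivered in this interval. -/
structure Policy (N M : ℕ) where
  assign : List (IntervalRecord N M) → Fin M → Fin N
  transmit : List (IntervalRecord N M) → IntervalRecord N M → Fin N → Option (Fin M)
  transmit_mem_buffer : ∀ past cur i j, transmit past cur i = some j →
    cur.assignment j = i ∧ ¬ cur.Delivered j

namespace Policy

variable {N M : ℕ}

/-- The events of an interval during its first `t` time-slots, when the past intervals are `past`,
and `x s i j` tells whether the channel from `i` to `j` is good in time-slot `s` of the interval. -/
def runInterval (η : Policy N M) (past : List (IntervalRecord N M))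
    (x : ℕ → Fin N → Fin M → Bool) : ℕ → IntervalRecord N M
  | 0 => ⟨η.assign past, []⟩
  | t + 1 =>
    let cur := η.runInterval past x t
    ⟨cur.assignment,
      cur.slots ++ [fun i => (η.transmit past cur i).map fun j => (j, x t i j)]⟩

/-- The history of the first `k` intervals of `τ` time-slots each, where `ω n i j` tells whether the
channel from `i` to `j` is good in time-slot `n` (counted from the very beginning). -/
def history (η : Policy N M) (τ : ℕ) (ω : ℕ → Fin N → Fin M → Bool) :
    ℕ → List (IntervalRecord N M)
  | 0 => []
  | k + 1 =>
    η.history τ ω k ++ [η.runInterval (η.history τ ω k) (fun t => ω (k * τ + t)) τ]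

open Classical in
/-- `N_j(k, η)`: equals `1` if client `j` receives its packet in interval `k` (with `k = 0, 1, …`),
and `0` otherwise. -/
noncomputable def deliveries (η : Policy N M) (τ : ℕ) (ω : ℕ → Fin N → Fin M → Bool)
    (k : ℕ) (j : Fin M) : ℕ :=
  if (η.runInterval (η.history τ ω k) (fun t => ω (k * τ + t)) τ).Delivered j then 1 else 0

end Policy

namespace Network

variable {N : ℕ} (W : Network N)

/-- The law of the channel states: the states (`true` = success) of all channels in all time-slots
are independent, and the channel from `i` to `j` is good with probability `p i j`. -/
noncomputable def channelLaw : MeasureTheory.Measure (ℕ → Fin N → Fin W.M → Bool) :=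
  MeasureTheory.Measure.infinitePi fun _ : ℕ =>
    MeasureTheory.Measure.pi fun i => MeasureTheory.Measure.pi fun j =>
      ProbabilityTheory.bernoulliMeasure true false (W.p i j)

/-- The long-term average number of deliveries per interval, on the sample path `ω`. -/
noncomputable def pathThroughput (η : Policy N W.M) (ω : ℕ → Fin N → Fin W.M → Bool) : ℝ :=
  Filter.limsup
    (fun r : ℕ => (∑ k ∈ Finset.range r, ∑ j, (η.deliveries W.τ ω k j : ℝ)) / (r : ℝ))
    Filter.atTop

/-- The total timely throughput of a policy: the largest `R` such that, with probability one, the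
long-term average number of deliveries per interval is at least `R`. -/
noncomputable def totalTimelyThroughput (η : Policy N W.M) : ℝ :=
  sSup {R : ℝ | ∀ᵐ ω ∂W.channelLaw, R ≤ W.pathThroughput η ω}

/-- `C_T3`: the maximum total timely throughput over all scheduling policies. -/
noncomputable def CT3 : ℝ := ⨆ η : Policy N W.M, W.totalTimelyThroughput η

/-- Feasibility in the relaxed problem: `x i j ∈ {0, 1}`, the packets assigned to an access point,
where the packet of `j` has size `1 / p i j` at `i` (infinite if `p i j = 0`, and `0 / 0 = 0`), fit
into a bin of capacity `τ`, and each packet is assigned at most once. -/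
structure RelaxedFeasible (x : Fin N → Fin W.M → ℕ) : Prop where
  zero_or_one : ∀ i j, x i j = 0 ∨ x i j = 1
  capacity : ∀ i, ∑ j, (x i j : ℝ≥0∞) / ENNReal.ofReal (W.p i j : ℝ) ≤ (W.τ : ℝ≥0∞)
  assigned_once : ∀ j, ∑ i, x i j ≤ 1

/-- `C_det`: the maximum value of the relaxed problem. -/
noncomputable def Cdet : ℕ :=
  sSup {v : ℕ | ∃ x : Fin N → Fin W.M → ℕ, W.RelaxedFeasible x ∧ v = ∑ i, ∑ j, x i j}

end Network

/-! Both claims use networks in which each client has a single owner, the only access point that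
reaches it, and all owned links have the same probability `p`. Under any policy, the choice of
packet in a slot depends only on the past, and all clients owned by one access point have the same
success probability. The outcomes seen by the access points are therefore i.i.d. Bernoulli(`p`),
whatever the policy (`measurePreserving_infinitePi_of_adapted`). An access point with at most `l`
clients delivers at most `min l B` packets per interval, where `B` counts its successes
(`sum_deliveries_le`). By the strong law the throughput is at most the sum of the means of these
minima (`CT3_le_expectedCappedCount`). For (1), one client per access point and `τ = 1`: the bound
`N * p` is attained, while a packet of size `1 / p > 1` fits in no bin, so `Cdet = 0`. For (2), `l`
clients per access point, `p = 1 / 2` and `τ = 2 * l`: all packets fit exactly, but `B` fluctuates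
by order `√l` around its mean `l`, and the cap turns this into a loss of order `√l` per access point
(`expectedCappedCount_half_le`). -/

/-! ### Adapted selections and block averages of i.i.d. sequences -/

open MeasureTheory ProbabilityTheory in
/-- If `Y n` is obtained from the `n`-th of a sequence of i.i.d. variables by a map that depends only
on the previous ones and that always has the same image measure `ν`, then the `Y n` are i.i.d. with
law `ν`. -/
theorem measurePreserving_infinitePi_of_adapted {E G : Type*} [MeasurableSpace E] [Finite E]
    [Inhabited E] [MeasurableSingletonClass E] [MeasurableSpace G] (μ : Measure E)
    [IsProbabilityMeasure μ] (ν : Measure G) [IsProbabilityMeasure ν]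
    (g : ℕ → (ℕ → E) → E → G)
    (hg : ∀ n ω ω', (∀ m < n, ω m = ω' m) → g n ω = g n ω')
    (hν : ∀ n ω, μ.map (g n ω) = ν) :
    MeasurePreserving (fun ω n => g n ω (ω n)) (Measure.infinitePi fun _ : ℕ => μ)
      (Measure.infinitePi fun _ : ℕ => ν) := by
  set P := Measure.infinitePi fun _ : ℕ => μ with hP
  -- The padding value is irrelevant: by `hg`, `g m` with `m ≤ n` reads only coordinates below `n`.
  let ext (n : ℕ) (u : Finset.range n → E) (m : ℕ) : E :=
    if h : m ∈ Finset.range n then u ⟨m, h⟩ else default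
  let X (n : ℕ) (ω : ℕ → E) (m : Finset.range n) : E := ω m
  have hX (n : ℕ) : Measurable (X n) := by fun_prop
  have hext (n m : ℕ) (ω : ℕ → E) (h : m < n) : ext n (X n ω) m = ω m := by
    simp [ext, X, h]
  have hgext (n m : ℕ) (ω : ℕ → E) (h : m ≤ n) : g m (ext n (X n ω)) = g m ω :=
    hg _ _ _ fun k hk => hext _ _ _ (by omega)
  have hmeas : Measurable (fun ω n => g n ω (ω n)) := by
    refine measurable_pi_lambda _ fun n => ?_
    have h1 : (fun ω => g n ω (ω n)) =
        (fun u => g n (ext (n + 1) u) (ext (n + 1) u n)) ∘ X (n + 1) := by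
      funext ω
      simp only [Function.comp]
      rw [hgext _ _ _ (by omega), hext _ _ _ (by omega)]
    rw [h1]
    exact (measurable_of_finite _).comp (hX _)
  -- Box probabilities factor, by induction on the length: given the first `n` coordinates, the next
  -- output has law `ν`.
  have hbox : ∀ (t : ℕ → Set G), (∀ n, MeasurableSet (t n)) → ∀ n,
      P {ω | ∀ m < n, g m ω (ω m) ∈ t m} = ∏ m ∈ Finset.range n, ν (t m) := by
    intro t ht n
    induction n with
    | zero => simp
    | succ n ih =>
      let A : Set (Finset.range n → E) := {u | ∀ m < n, g m (ext n u) (ext n u m) ∈ t m}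
      let S : Set ((Finset.range n → E) × E) := {q | q.1 ∈ A ∧ g n (ext n q.1) q.2 ∈ t n}
      have hXA : X n ⁻¹' A = {ω | ∀ m < n, g m ω (ω m) ∈ t m} := by
        ext ω
        simp only [A, Set.mem_preimage, Set.mem_ofPred_eq]
        refine forall₂_congr fun m hm => ?_
        rw [hgext _ _ _ hm.le, hext _ _ _ hm]
      have hS : (fun ω => (X n ω, ω n)) ⁻¹' S = {ω | ∀ m < n + 1, g m ω (ω m) ∈ t m} := by
        ext ω
        have : X n ω ∈ A ↔ ∀ m < n, g m ω (ω m) ∈ t m := by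
          rw [← Set.mem_preimage, hXA]; rfl
        simp only [S, Set.mem_preimage, Set.mem_ofPred_eq, this, hgext n n ω le_rfl,
          Nat.forall_lt_succ_right]
      have hind : IndepFun (X n) (fun ω => ω n) P := by
        have h1 : iIndepFun (fun (i : ℕ) (ω : ℕ → E) => ω i) P :=
          iIndepFun_infinitePi (X := fun _ => id) (fun _ => measurable_id)
        have h2 := h1.indepFun_finset (Finset.range n) {n} (by simp) (fun i => by fun_prop)
        exact h2.comp (φ := id) 
          (ψ := fun v : (({n} : Finset ℕ) → E) => v ⟨n, by simp⟩) measurable_id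
          (measurable_pi_apply (⟨n, by simp⟩ : ({n} : Finset ℕ)))
      have hlaw : P.map (fun ω => ω n) = μ := (measurePreserving_eval_infinitePi _ n).map_eq
      have hSm : MeasurableSet S := S.toFinite.measurableSet
      have hAm : MeasurableSet A := A.toFinite.measurableSet
      rw [← hS, ← Measure.map_apply ((hX n).prodMk (by fun_prop)) hSm,
        (indepFun_iff_map_prod_eq_prod_map_map (hX n).aemeasurable
          (measurable_pi_apply n).aemeasurable).1 hind, hlaw,
        Measure.prod_apply hSm, Finset.prod_range_succ, ← ih, ← hXA,
        ← Measure.map_apply (hX n) hAm, mul_comm, ← lintegral_indicator_const hAm]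
      -- The fibre of `S` over a past `u` has mass `ν (t n)` if `u ∈ A` and `0` otherwise.
      refine lintegral_congr fun u => ?_
      by_cases hu : u ∈ A
      · rw [Set.indicator_of_mem hu, ← hν n (ext n u),
          Measure.map_apply (measurable_of_finite _) (ht n)]
        congr 1
        ext e
        simp [S, hu]
      · rw [Set.indicator_of_notMem hu]
        have : Prod.mk u ⁻¹' S = ∅ := by
          ext e
          simp [S, hu]
        rw [this, measure_empty]
  refine ⟨hmeas, Measure.eq_infinitePi _ fun s t ht => ?_⟩
  obtain ⟨n, hn⟩ : ∃ n, s ⊆ Finset.range n := ⟨s.sup id + 1, s.subset_range_sup_succ⟩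
  classical
  have h1 := hbox (fun m => if m ∈ s then t m else Set.univ)
    (fun m => by split_ifs; exacts [ht m, .univ]) n
  rw [Measure.map_apply hmeas (.pi s.countable_toSet fun i _ => ht i)]
  convert h1 using 1
  · congr 1
    ext ω
    simp only [Set.mem_preimage, Set.mem_pi, Finset.mem_coe, Set.mem_ofPred_eq]
    constructor
    · intro h m _
      split_ifs with hm
      exacts [h m hm, trivial]
    · intro h m hm
      simpa [hm] using h m (Finset.mem_range.1 (hn hm))
  · rw [← Finset.prod_subset hn]
    · exact Finset.prod_congr rfl fun m hm => by simp [hm]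
    · intro m _ hm
      simp [hm]

open MeasureTheory ProbabilityTheory in
/-- Cutting an i.i.d. sequence into consecutive blocks of length `τ` yields an i.i.d. sequence. -/
theorem measurePreserving_infinitePi_blocks {G : Type*} [MeasurableSpace G] (ν : Measure G)
    [IsProbabilityMeasure ν] {τ : ℕ} (hτ : 0 < τ) :
    MeasurePreserving (fun (y : ℕ → G) (k : ℕ) (t : Fin τ) => y (k * τ + t))
      (Measure.infinitePi fun _ : ℕ => ν)
      (Measure.infinitePi fun _ : ℕ => Measure.pi fun _ : Fin τ => ν) := by
  have : NeZero τ := ⟨hτ.ne'⟩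
  refine ⟨by fun_prop, ?_⟩
  have h1 := Measure.infinitePi_map_piCongrLeft (X := fun _ : ℕ × Fin τ => G) (fun _ => ν)
    (Nat.divModEquiv τ)
  have h2 := Measure.infinitePi_map_curry (ι := ℕ) (κ := Fin τ) (fun _ _ => ν)
  rw [← h1, Measure.map_map (by fun_prop) (by fun_prop)] at h2
  simp only [Measure.infinitePi_eq_pi] at h2
  rw [← h2]
  congr 1
  funext y k t
  simp [MeasurableEquiv.piCongrLeft, Equiv.piCongrLeft, MeasurableEquiv.curry, Nat.divModEquiv]

open MeasureTheory ProbabilityTheory in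
/-- Strong law of large numbers for a bounded function of an i.i.d. sequence on finite blocks. -/
theorem ae_tendsto_average_blocks {G : Type*} [MeasurableSpace G] [Finite G]
    [MeasurableSingletonClass G] (ν : Measure G)
    [IsProbabilityMeasure ν] {τ : ℕ} (hτ : 0 < τ) (f : (Fin τ → G) → ℝ) :
    ∀ᵐ y ∂Measure.infinitePi (fun _ : ℕ => ν),
      Filter.Tendsto (fun r : ℕ => (∑ k ∈ Finset.range r, f fun t => y (k * τ + t)) / (r : ℝ))
        Filter.atTop (nhds (∫ z, f z ∂Measure.pi fun _ : Fin τ => ν)) := by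
  set Q := Measure.pi fun _ : Fin τ => ν
  have hf : Measurable f := measurable_of_finite f
  have hid (k : ℕ) : MeasurePreserving (fun z : ℕ → Fin τ → G => z k)
      (Measure.infinitePi fun _ : ℕ => Q) Q := measurePreserving_eval_infinitePi _ k
  have hind : iIndepFun (fun (k : ℕ) (z : ℕ → Fin τ → G) => f (z k))
      (Measure.infinitePi fun _ : ℕ => Q) := iIndepFun_infinitePi (X := fun _ => f) fun _ => hf
  have h := strong_law_ae_real (μ := Measure.infinitePi fun _ : ℕ => Q)
    (fun (k : ℕ) (z : ℕ → Fin τ → G) => f (z k))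
    ((hid 0).integrable_comp_of_integrable (Integrable.of_finite (f := f)))
    (fun i j hij => hind.indepFun hij)
    (fun k => ⟨(hf.comp (hid k).measurable).aemeasurable,
      (hf.comp (hid 0).measurable).aemeasurable, by
      rw [← Function.comp_def f, ← Function.comp_def f, ← Measure.map_map hf (hid k).measurable,
        ← Measure.map_map hf (hid 0).measurable, (hid k).map_eq, (hid 0).map_eq]⟩)
  have h0 : ∫ z, f (z 0) ∂(Measure.infinitePi fun _ : ℕ => Q) = ∫ z, f z ∂Q := by
    rw [← (hid 0).map_eq, integral_map (hid 0).measurable.aemeasurable hf.aestronglyMeasurable,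
      (hid 0).map_eq]
  rw [h0] at h
  exact (measurePreserving_infinitePi_blocks ν hτ).quasiMeasurePreserving.ae h

open MeasureTheory in
-- Fubini on the first coordinate; this drives the moment computation by induction on the number of
-- summands.
theorem integral_pi_sum_succ {G : Type*} [MeasurableSpace G] [Finite G]
    [MeasurableSingletonClass G] (ν : Measure G) [IsProbabilityMeasure ν] (c : G → ℝ) (f : ℝ → ℝ)
    (n : ℕ) :
    ∫ z, f (∑ t, c (z t)) ∂Measure.pi (fun _ : Fin (n + 1) => ν) =
      ∫ g, ∫ z, f (c g + ∑ t, c (z t)) ∂Measure.pi (fun _ : Fin n => ν) ∂ν := by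
  rw [← ((measurePreserving_piFinSuccAbove (fun _ : Fin (n + 1) => ν) 0).symm).integral_comp',
    integral_prod _ Integrable.of_finite]
  simp [MeasurableEquiv.piFinSuccAbove_symm_apply, Fin.insertNthEquiv, Fin.sum_univ_succ]

/-! ### Policies are non-anticipating -/

theorem Policy.delivered_runInterval_iff {N M : ℕ} (η : Policy N M)
    (past : List (IntervalRecord N M)) (x : ℕ → Fin N → Fin M → Bool) (t : ℕ) (j : Fin M) :
    (η.runInterval past x t).Delivered j ↔
      ∃ s < t, ∃ i, η.transmit past (η.runInterval past x s) i = some j ∧ x s i j = true := by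
  induction t with
  | zero => simp [Policy.runInterval, IntervalRecord.Delivered]
  | succ t ih =>
    have h1 : (η.runInterval past x (t + 1)).Delivered j ↔
        (η.runInterval past x t).Delivered j ∨
          ∃ i, η.transmit past (η.runInterval past x t) i = some j ∧ x t i j = true := by
      simp only [Policy.runInterval, IntervalRecord.Delivered, List.mem_append, List.mem_singleton,
        or_and_right, exists_or, exists_eq_left, Option.map_eq_some_iff, Prod.mk.injEq]
      refine or_congr Iff.rfl (exists_congr fun i => ⟨?_, ?_⟩)
      · rintro ⟨j', h, rfl, h'⟩
        exact ⟨h, h'⟩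
      · rintro ⟨h, h'⟩
        exact ⟨j, h, rfl, h'⟩
    rw [h1, ih]
    constructor
    · rintro (⟨s, hs, h⟩ | h)
      exacts [⟨s, by omega, h⟩, ⟨t, by omega, h⟩]
    · rintro ⟨s, hs, h⟩
      rcases Nat.lt_succ_iff_lt_or_eq.1 hs with hs | rfl
      exacts [Or.inl ⟨s, hs, h⟩, Or.inr h]

theorem Policy.runInterval_congr {N M : ℕ} (η : Policy N M) (past : List (IntervalRecord N M))
    {x x' : ℕ → Fin N → Fin M → Bool} {t : ℕ} (h : ∀ s < t, x s = x' s) :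
    η.runInterval past x t = η.runInterval past x' t := by
  induction t with
  | zero => rfl
  | succ t ih =>
    simp only [Policy.runInterval]
    rw [ih fun s hs => h s (by omega), h t (by omega)]

theorem Policy.history_congr {N M : ℕ} (η : Policy N M) (τ : ℕ)
    {ω ω' : ℕ → Fin N → Fin M → Bool} {k : ℕ} (h : ∀ m < k * τ, ω m = ω' m) :
    η.history τ ω k = η.history τ ω' k := by
  induction k with
  | zero => rfl
  | succ k ih =>
    rw [Nat.succ_mul] at h
    simp only [Policy.history]
    rw [ih fun m hm => h m (by omega),
      η.runInterval_congr _ fun s hs => h (k * τ + s) (by omega)]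

/-- The client whose packet access point `i` transmits in time-slot `n`, if any. -/
def Policy.transmission {N M : ℕ} (η : Policy N M) (τ : ℕ) (n : ℕ)
    (ω : ℕ → Fin N → Fin M → Bool) (i : Fin N) : Option (Fin M) :=
  η.transmit (η.history τ ω (n / τ))
    (η.runInterval (η.history τ ω (n / τ)) (fun t => ω (n / τ * τ + t)) (n % τ)) i

/-- The inequality `m < n` is strict: the choice in slot `n` precedes the outcome in slot `n`, as
independence requires. -/
theorem Policy.transmission_congr {N M : ℕ} (η : Policy N M) (τ : ℕ) {n : ℕ}
    {ω ω' : ℕ → Fin N → Fin M → Bool} (h : ∀ m < n, ω m = ω' m) :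
    η.transmission τ n ω = η.transmission τ n ω' := by
  have hn := Nat.div_add_mod' n τ
  funext i
  simp only [Policy.transmission]
  rw [η.history_congr τ fun m hm => h m (by omega),
    η.runInterval_congr _ fun s hs => h (n / τ * τ + s) (by omega)]

theorem Policy.deliveries_eq_one_iff {N M : ℕ} (η : Policy N M) (τ : ℕ)
    (ω : ℕ → Fin N → Fin M → Bool) (k : ℕ) (j : Fin M) :
    η.deliveries τ ω k j = 1 ↔ ∃ t : Fin τ, ∃ i,
      η.transmission τ (k * τ + t) ω i = some j ∧ ω (k * τ + t) i j = true := by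
  have h1 : η.deliveries τ ω k j = 1 ↔
      (η.runInterval (η.history τ ω k) (fun t => ω (k * τ + t)) τ).Delivered j := by
    simp [Policy.deliveries]
  rw [h1, η.delivered_runInterval_iff]
  have h2 (t : Fin τ) : (k * τ + t) / τ = k ∧ (k * τ + t) % τ = t := by
    have := t.isLt
    rw [Nat.mul_comm, Nat.mul_add_div (by omega), Nat.mul_add_mod, Nat.div_eq_of_lt t.isLt,
      Nat.mod_eq_of_lt t.isLt]
    simp
  constructor
  · rintro ⟨s, hs, i, h⟩
    refine ⟨⟨s, hs⟩, i, ?_⟩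
    simpa only [Policy.transmission, h2 ⟨s, hs⟩] using h
  · rintro ⟨t, i, h⟩
    refine ⟨t, t.isLt, i, ?_⟩
    simpa only [Policy.transmission, h2 t] using h

theorem Policy.deliveries_zero_or_one {N M : ℕ} (η : Policy N M) (τ : ℕ)
    (ω : ℕ → Fin N → Fin M → Bool) (k : ℕ) (j : Fin M) :
    η.deliveries τ ω k j = 0 ∨ η.deliveries τ ω k j = 1 := by
  unfold Policy.deliveries
  split_ifs <;> simp

/-! ### Networks with owned clients: the throughput bound for every policy -/

/-- A network in which client `j` can only be reached from access point `owner j`. -/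
noncomputable def Network.ofOwner {N M : ℕ} (owner : Fin M → Fin N) (τ : ℕ) (p : unitInterval)
    (hM : 0 < M) (hτ : 0 < τ) : Network N where
  M := M
  τ := τ
  M_pos := hM
  τ_pos := hτ
  p i j := if owner j = i then p else 0

/-- The number of successes of the Bernoulli sequences `z · i`, `i : Fin N`, each one capped at `l`. -/
noncomputable def cappedCount {N τ : ℕ} (l : ℕ) (z : Fin τ → Fin N → Bool) : ℝ :=
  ∑ i, min (l : ℝ) (∑ t, if z t i then 1 else 0)

open MeasureTheory ProbabilityTheory in
/-- The expectation of `cappedCount` under independent Bernoulli variables. -/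
noncomputable def expectedCappedCount (N τ l : ℕ) (p : unitInterval) : ℝ :=
  ∫ z, cappedCount l z ∂Measure.pi fun _ : Fin τ => Measure.pi fun _ : Fin N =>
    bernoulliMeasure true false p

theorem expectedCappedCount_nonneg (N τ l : ℕ) (p : unitInterval) :
    0 ≤ expectedCappedCount N τ l p :=
  MeasureTheory.integral_nonneg fun z => Finset.sum_nonneg fun i _ =>
    le_min (by positivity) (Finset.sum_nonneg fun t _ => by split_ifs <;> norm_num)

namespace Network

variable {N M : ℕ} (owner : Fin M → Fin N) (τ : ℕ) (p : unitInterval) (hM : 0 < M) (hτ : 0 < τ)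

instance (W : Network N) : MeasureTheory.IsProbabilityMeasure W.channelLaw := by
  unfold Network.channelLaw
  infer_instance

open MeasureTheory ProbabilityTheory in
theorem channelLaw_ofOwner : (ofOwner owner τ p hM hτ).channelLaw =
    Measure.infinitePi fun _ : ℕ => Measure.pi fun i : Fin N => Measure.pi fun j : Fin M =>
      bernoulliMeasure true false (if owner j = i then p else 0) :=
  rfl

open MeasureTheory ProbabilityTheory in
theorem ae_eq_false_of_owner_ne :
    ∀ᵐ ω ∂(ofOwner owner τ p hM hτ).channelLaw, ∀ (n : ℕ) (i : Fin N) (j : Fin M),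
      owner j ≠ i → ω n i j = false := by
  rw [ae_all_iff]; intro n
  rw [ae_all_iff]; intro i
  rw [ae_all_iff]; intro j
  by_cases h : owner j = i
  · simp [h]
  have h1 : MeasurePreserving (fun ω : ℕ → Fin N → Fin M → Bool => ω n i j)
      (ofOwner owner τ p hM hτ).channelLaw (Measure.dirac false) := by
    have := ((measurePreserving_eval (fun j => bernoulliMeasure true false
      ((ofOwner owner τ p hM hτ).p i j)) j).comp (measurePreserving_eval
        (fun i => Measure.pi fun j => bernoulliMeasure true false
          ((ofOwner owner τ p hM hτ).p i j)) i)).comp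
      (measurePreserving_eval_infinitePi (fun _ : ℕ => Measure.pi fun i => Measure.pi fun j =>
        bernoulliMeasure true false ((ofOwner owner τ p hM hτ).p i j)) n)
    have hp : (ofOwner owner τ p hM hτ).p i j = 0 := by simp [ofOwner, h]
    rw [hp, bernoulliMeasure_zero] at this
    exact this
  have h2 := h1.quasiMeasurePreserving.ae
    (p := fun b => b = false) (by simp [ae_dirac_eq])
  filter_upwards [h2] with ω hω _ using hω

open MeasureTheory ProbabilityTheory in
-- Each selected channel belongs to its access point, so its state has law Bernoulli(`p`) whatever
-- the past; the strong law on blocks then applies.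
theorem ae_tendsto_average_selected (c : ℕ → (ℕ → Fin N → Fin M → Bool) → Fin N → Fin M)
    (hc : ∀ n ω ω', (∀ m < n, ω m = ω' m) → c n ω = c n ω')
    (hown : ∀ n ω i, owner (c n ω i) = i) (l : ℕ) :
    ∀ᵐ ω ∂(ofOwner owner τ p hM hτ).channelLaw,
      Filter.Tendsto (fun r : ℕ => (∑ k ∈ Finset.range r,
        cappedCount l fun (t : Fin τ) i => ω (k * τ + t) i (c (k * τ + t) ω i)) / (r : ℝ))
        Filter.atTop (nhds (expectedCappedCount N τ l p)) := by
  let q (i : Fin N) (j : Fin M) : unitInterval := if owner j = i then p else 0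
  have h1 := measurePreserving_infinitePi_of_adapted
    (Measure.pi fun i => Measure.pi fun j => bernoulliMeasure true false (q i j))
    (Measure.pi fun _ : Fin N => bernoulliMeasure true false p)
    (fun n ω e i => e i (c n ω i))
    (fun n ω ω' h => by rw [hc n ω ω' h])
    (fun n ω => by
      have h2 (i : Fin N) : (Measure.pi fun j => bernoulliMeasure true false (q i j)).map
          (fun e => e (c n ω i)) = bernoulliMeasure true false p := by
        rw [(measurePreserving_eval (fun j => bernoulliMeasure true false (q i j))
          (c n ω i)).map_eq]
        simp [q, hown]
      have (i : Fin N) : IsProbabilityMeasure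
          ((Measure.pi fun j => bernoulliMeasure true false (q i j)).map
            (fun e => e (c n ω i))) := by
        rw [h2]; infer_instance
      have h3 := Measure.pi_map_pi
        (μ := fun i => Measure.pi fun j => bernoulliMeasure true false (q i j))
        (f := fun i (e : Fin M → Bool) => e (c n ω i))
        (fun i => (measurable_pi_apply _).aemeasurable)
      simp only [h2] at h3
      exact h3)
  rw [channelLaw_ofOwner]
  exact h1.quasiMeasurePreserving.ae (ae_tendsto_average_blocks _ hτ (cappedCount l))

/-- For each access point, the cap `l` bounds its number of clients. The other bound sends a
delivered client to a slot of its delivery, which is injective because an access point transmits at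
most one packet per slot. -/
theorem sum_deliveries_le (η : Policy N M) {l : ℕ}
    (hl : ∀ i, (Finset.univ.filter fun j => owner j = i).card ≤ l)
    (c : ℕ → (ℕ → Fin N → Fin M → Bool) → Fin N → Fin M) (ω : ℕ → Fin N → Fin M → Bool)
    (hω : ∀ n i j, owner j ≠ i → ω n i j = false)
    (hc : ∀ n i j, η.transmission τ n ω i = some j → owner j = i → c n ω i = j) (k : ℕ) :
    ∑ j, (η.deliveries τ ω k j : ℝ) ≤
      cappedCount l fun (t : Fin τ) i => ω (k * τ + t) i (c (k * τ + t) ω i) := by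
  classical
  have hfib : ∑ j, (η.deliveries τ ω k j : ℝ) =
      ∑ i, ∑ j with owner j = i, (η.deliveries τ ω k j : ℝ) :=
    (Finset.sum_fiberwise _ _ _).symm
  rw [hfib]
  refine Finset.sum_le_sum fun i _ => ?_
  let D := Finset.univ.filter fun j => owner j = i ∧ η.deliveries τ ω k j = 1
  have hD : ∑ j with owner j = i, (η.deliveries τ ω k j : ℝ) = D.card := by
    rw [Finset.card_eq_sum_ones, Nat.cast_sum]
    simp only [D]
    rw [← Finset.filter_filter, Finset.sum_filter (fun j => η.deliveries τ ω k j = 1)]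
    refine Finset.sum_congr rfl fun j _ => ?_
    rcases η.deliveries_zero_or_one τ ω k j with h | h <;> simp [h]
  rw [hD]
  refine le_min ?_ ?_
  · exact_mod_cast (Finset.card_le_card fun j hj => by
      simp only [D, Finset.mem_filter] at hj ⊢
      exact ⟨hj.1, hj.2.1⟩).trans (hl i)
  · rw [← Finset.sum_filter, Finset.sum_const, nsmul_eq_mul, mul_one, Nat.cast_le]
    have h1 (j : Fin M) (hj : j ∈ D) : ∃ t : Fin τ,
        η.transmission τ (k * τ + t) ω i = some j ∧ ω (k * τ + t) i j = true := by
      simp only [D, Finset.mem_filter, Finset.mem_univ, true_and] at hj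
      obtain ⟨t, i', h, h'⟩ := (η.deliveries_eq_one_iff τ ω k j).1 hj.2
      have : i' = i := by
        by_contra hne
        simp [hω _ i' j (by rw [hj.1]; exact Ne.symm hne)] at h'
      exact ⟨t, this ▸ h, this ▸ h'⟩
    rcases D.eq_empty_or_nonempty with h0 | ⟨j₀, hj₀⟩
    · simp [h0]
    have : Nonempty (Fin τ) := ⟨(h1 j₀ hj₀).choose⟩
    choose! f hf using h1
    refine Finset.card_le_card_of_injOn f (fun j hj => ?_) fun j hj j' hj' hjj => ?_
    · have hown : owner j = i := by
        have := hj
        simp only [D, Finset.mem_coe, Finset.mem_filter] at this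
        exact this.2.1
      simp only [Finset.coe_filter, Finset.mem_univ, true_and, Set.mem_ofPred_eq]
      rw [hc _ i j (hf j hj).1 hown]
      exact (hf j hj).2
    · have h2 := (hf j hj).1
      rw [hjj, (hf j' hj').1] at h2
      exact (Option.some.inj h2).symm

theorem ae_pathThroughput_le {l : ℕ}
    (hl : ∀ i, (Finset.univ.filter fun j => owner j = i).card ≤ l)
    (hsurj : Function.Surjective owner) (η : Policy N M) :
    ∀ᵐ ω ∂(ofOwner owner τ p hM hτ).channelLaw,
      (ofOwner owner τ p hM hτ).pathThroughput η ω ≤ expectedCappedCount N τ l p := by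
  classical
  obtain ⟨d, hd⟩ := hsurj.hasRightInverse
  -- An idle access point, or one transmitting to a client it does not own, is given the fallback
  -- client `d i`. This only adds successes, and makes the selection always owned.
  let c : ℕ → (ℕ → Fin N → Fin M → Bool) → Fin N → Fin M := fun n ω i =>
    if owner ((η.transmission τ n ω i).getD (d i)) = i then (η.transmission τ n ω i).getD (d i)
    else d i
  have h1 := ae_tendsto_average_selected owner τ p hM hτ c
    (fun n ω ω' h => by simp only [c, η.transmission_congr τ h])
    (fun n ω i => by
      simp only [c]
      split_ifs with h
      exacts [h, hd i]) l
  filter_upwards [h1, ae_eq_false_of_owner_ne owner τ p hM hτ] with ω h hω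
  rw [← h.limsup_eq]
  refine Filter.limsup_le_limsup (Filter.Eventually.of_forall fun r => ?_) ?_
    h.isBoundedUnder_le
  · refine div_le_div_of_nonneg_right (Finset.sum_le_sum fun k _ => ?_) (Nat.cast_nonneg r)
    refine sum_deliveries_le owner τ η hl c ω hω (fun n i j hj ho => ?_) k
    simp [c, hj, ho]
  · refine Filter.IsBoundedUnder.isCoboundedUnder_le ⟨0, Filter.eventually_map.2 <|
      Filter.Eventually.of_forall fun r => ?_⟩
    exact div_nonneg (Finset.sum_nonneg fun k _ => Finset.sum_nonneg fun j _ =>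
      Nat.cast_nonneg _) (Nat.cast_nonneg r)

theorem totalTimelyThroughput_le {W : Network N} {η : Policy N W.M} {C : ℝ} (hC : 0 ≤ C)
    (h : ∀ᵐ ω ∂W.channelLaw, W.pathThroughput η ω ≤ C) : W.totalTimelyThroughput η ≤ C := by
  refine Real.sSup_le (fun R hR => ?_) hC
  have hR : ∀ᵐ ω ∂W.channelLaw, R ≤ W.pathThroughput η ω := hR
  obtain ⟨ω, h1, h2⟩ := (hR.and h).exists
  exact h1.trans h2

theorem CT3_le_expectedCappedCount {l : ℕ}
    (hl : ∀ i, (Finset.univ.filter fun j => owner j = i).card ≤ l)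
    (hsurj : Function.Surjective owner) :
    (ofOwner owner τ p hM hτ).CT3 ≤ expectedCappedCount N τ l p :=
  Real.iSup_le (fun η => totalTimelyThroughput_le (expectedCappedCount_nonneg N τ l p)
    (ae_pathThroughput_le owner τ p hM hτ hl hsurj η)) (expectedCappedCount_nonneg N τ l p)

/-- A real supremum over an unbounded set is `0` by convention; the common bound `C` makes both
suprema, over `R` and over policies, genuine. -/
theorem le_CT3 {W : Network N} {C : ℝ} (hC : 0 ≤ C)
    (h : ∀ η : Policy N W.M, ∀ᵐ ω ∂W.channelLaw, W.pathThroughput η ω ≤ C) (η : Policy N W.M)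
    {R : ℝ} (hR : ∀ᵐ ω ∂W.channelLaw, R ≤ W.pathThroughput η ω) : R ≤ W.CT3 := by
  have h1 : R ≤ W.totalTimelyThroughput η := by
    refine le_csSup ⟨C, fun R' hR' => ?_⟩ hR
    have hR' : ∀ᵐ ω ∂W.channelLaw, R' ≤ W.pathThroughput η ω := hR'
    obtain ⟨ω, h1, h2⟩ := (hR'.and (h η)).exists
    exact h1.trans h2
  refine h1.trans (le_ciSup (f := fun η => W.totalTimelyThroughput η) ⟨C, ?_⟩ η)
  rintro _ ⟨η', rfl⟩
  exact totalTimelyThroughput_le hC (h η')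

theorem sum_le_of_relaxedFeasible {W : Network N} {x : Fin N → Fin W.M → ℕ}
    (hx : W.RelaxedFeasible x) : ∑ i, ∑ j, x i j ≤ W.M := by
  rw [Finset.sum_comm]
  calc ∑ j, ∑ i, x i j ≤ ∑ _j : Fin W.M, 1 := Finset.sum_le_sum fun j _ => hx.assigned_once j
    _ = W.M := by simp

end Network

/-! ### Expected loss of a capped binomial variable -/

open MeasureTheory in
/-- The polynomials of degree four in a sum of independent fair signs `± 1 / 2`. -/
theorem integral_quartic_sum_signs {G : Type*} [MeasurableSpace G] [Finite G]
    [MeasurableSingletonClass G] (ν : Measure G) [IsProbabilityMeasure ν] (c : G → ℝ)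
    (hc : ∀ f : ℝ → ℝ, ∫ g, f (c g) ∂ν = (f (1 / 2) + f (-(1 / 2))) / 2) (α β γ δ : ℝ) (n : ℕ) :
    ∀ x : ℝ, ∫ z, (fun s => α + β * s + γ * s ^ 2 + δ * s ^ 4) (x + ∑ t, c (z t))
        ∂Measure.pi (fun _ : Fin n => ν) =
      α + β * x + γ * (x ^ 2 + n / 4) +
        δ * (x ^ 4 + 3 / 2 * n * x ^ 2 + (3 * n ^ 2 - 2 * n) / 16) := by
  -- The starting point `x` stays general because splitting off one sign shifts it by `± 1 / 2`.
  induction n with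
  | zero => intro x; simp
  | succ n ih =>
    intro x
    rw [integral_pi_sum_succ ν c
      (fun u => (fun s => α + β * s + γ * s ^ 2 + δ * s ^ 4) (x + u)) n]
    simp only [← add_assoc]
    simp only [] at ih
    simp only [ih]
    rw [hc fun u => α + β * (x + u) + γ * ((x + u) ^ 2 + n / 4) +
        δ * ((x + u) ^ 4 + 3 / 2 * n * (x + u) ^ 2 + (3 * n ^ 2 - 2 * n) / 16)]
    push_cast
    ring

/-- Since `min 0 s = (s - |s|) / 2`, this amounts to `|s| / 2 ≥ b * s ^ 2 - b ^ 3 * s ^ 4`: a lower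
bound on the mean absolute deviation from the second and fourth moments alone, with no limit
theorem. -/
theorem min_zero_le_quartic {b : ℝ} (hb : 0 ≤ b) (s : ℝ) :
    min 0 s ≤ 0 + 1 / 2 * s + -b * s ^ 2 + b ^ 3 * s ^ 4 := by
  have key (u : ℝ) (hu : 0 ≤ u) : 0 ≤ u * (1 - 2 * (b * u) + 2 * (b * u) ^ 3) := by
    have hv : 0 ≤ b * u := mul_nonneg hb hu
    refine mul_nonneg hu ?_
    nlinarith [mul_nonneg hv (sq_nonneg (b * u - 1 / 2)), sq_nonneg (b * u - 1 / 2)]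
  rcases le_total 0 s with h | h
  · rw [min_eq_left h]
    nlinarith [key s h]
  · rw [min_eq_right h]
    nlinarith [key (-s) (by linarith)]

open MeasureTheory ProbabilityTheory in
theorem integral_pi_bernoulli_coord {N : ℕ} (p : unitInterval) (i : Fin N) (f : Bool → ℝ) :
    ∫ g, f (g i) ∂(Measure.pi fun _ : Fin N => bernoulliMeasure true false p) =
      p * f true + (1 - p) * f false := by
  have h := measurePreserving_eval (fun _ : Fin N => bernoulliMeasure true false p) i
  have h2 := integral_map (μ := Measure.pi fun _ : Fin N => bernoulliMeasure true false p)
    h.measurable.aemeasurable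
    (measurable_of_finite f).aestronglyMeasurable
  rw [h.map_eq, integral_bernoulliMeasure] at h2
  simpa using h2.symm

open MeasureTheory in
theorem expectedCappedCount_eq_sum (N τ l : ℕ) (p : unitInterval) :
    expectedCappedCount N τ l p = ∑ i : Fin N, ∫ z, min (l : ℝ) (∑ t, if z t i then 1 else 0)
      ∂Measure.pi fun _ : Fin τ => Measure.pi fun _ : Fin N =>
        ProbabilityTheory.bernoulliMeasure true false p :=
  integral_finsetSum _ fun _ _ => Integrable.of_finite

theorem expectedCappedCount_one_one (N : ℕ) (p : unitInterval) :
    expectedCappedCount N 1 1 p = N * p := by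
  rw [expectedCappedCount_eq_sum]
  set ν := MeasureTheory.Measure.pi fun _ : Fin N =>
    ProbabilityTheory.bernoulliMeasure true false p with hν
  have h (i : Fin N) : ∫ z, min ((1 : ℕ) : ℝ) (∑ t, if z t i then 1 else 0)
      ∂MeasureTheory.Measure.pi (fun _ : Fin 1 => ν) = p := by
    refine (integral_pi_sum_succ ν (fun g => if g i then 1 else 0)
      (fun s => min ((1 : ℕ) : ℝ) s) 0).trans ?_
    simp only [Finset.univ_eq_empty, Finset.sum_empty, add_zero, MeasureTheory.integral_const,
      MeasureTheory.probReal_univ, one_smul]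
    rw [hν, integral_pi_bernoulli_coord p i fun b => min ((1 : ℕ) : ℝ) (if b then 1 else 0)]
    simp
  refine (Finset.sum_congr rfl fun i _ => h i).trans ?_
  simp only [Finset.sum_const, Finset.card_univ, Fintype.card_fin, nsmul_eq_mul]

/-- The central limit scale loss of a binomial variable capped at its mean. -/
theorem expectedCappedCount_half_le (N l : ℕ) (hl : 1 ≤ l) {p : unitInterval}
    (hp : (p : ℝ) = 1 / 2) :
    expectedCappedCount N (2 * l) l p ≤ N * (l - 5 / 32 * Real.sqrt l) := by
  rw [expectedCappedCount_eq_sum]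
  set ν := MeasureTheory.Measure.pi fun _ : Fin N =>
    ProbabilityTheory.bernoulliMeasure true false p
  have hr : 0 < Real.sqrt l := Real.sqrt_pos.2 (by exact_mod_cast hl)
  have hr2 : Real.sqrt l ^ 2 = l := Real.sq_sqrt (by positivity)
  set r := Real.sqrt l
  have key (i : Fin N) : ∫ z, min (l : ℝ) (∑ t, if z t i then 1 else 0)
      ∂MeasureTheory.Measure.pi (fun _ : Fin (2 * l) => ν) ≤ l - 5 / 32 * r := by
    -- With `b` of order `1 / √l` both moment terms have order `√l`. The centred sum has second
    -- moment `l / 2` and fourth moment `3 * l ^ 2 / 4 - l / 4`; dropping the last term leaves `-r /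
    -- 4 + 3 * r / 32 = -5 * r / 32`.
    let b := 1 / (2 * r)
    have hb : 0 ≤ b := by positivity
    let c : (Fin N → Bool) → ℝ := fun g => if g i then 1 / 2 else -(1 / 2)
    have h1 := integral_quartic_sum_signs ν c (fun f => by
      rw [integral_pi_bernoulli_coord p i fun x => f (if x then 1 / 2 else -(1 / 2)), hp]
      simp only [if_true, Bool.false_eq_true, if_false]
      ring) l (1 / 2) (-b) (b ^ 3) (2 * l) 0
    have h2 : ∫ z, min (l : ℝ) (∑ t, if z t i then 1 else 0)
        ∂MeasureTheory.Measure.pi (fun _ : Fin (2 * l) => ν) ≤ _ :=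
      (MeasureTheory.integral_mono .of_finite .of_finite fun z => by
        have h3 : ∑ t, c (z t) = (∑ t, if z t i then 1 else 0) - (l : ℝ) := by
          have h4 (t : Fin (2 * l)) : c (z t) = (if z t i then 1 else 0) - 1 / 2 := by
            simp only [c]
            split_ifs <;> norm_num
          simp only [h4, Finset.sum_sub_distrib, Finset.sum_const, Finset.card_univ,
            Fintype.card_fin, nsmul_eq_mul]
          push_cast
          ring
        have h5 := min_zero_le_quartic hb (∑ t, c (z t))
        simp only [zero_add] at h5 ⊢
        have h6 : min (l : ℝ) (∑ t, if z t i then 1 else 0) = l + min 0 (∑ t, c (z t)) := by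
          rw [h3, ← min_add_add_left]
          simp
        rw [h6]
        linarith).trans_eq h1
    refine h2.trans ?_
    have hbr : b * r = 1 / 2 := by simp only [b]; field_simp
    have e1 : b * l = r / 2 := by rw [← hr2]; linear_combination r * hbr
    have e2 : b ^ 3 * l ^ 2 = r / 8 := by
      rw [← hr2]
      linear_combination (r * ((b * r) ^ 2 + (b * r) / 2 + 1 / 4)) * hbr
    have e3 : 0 ≤ b ^ 3 * l := by positivity
    push_cast
    nlinarith
  refine (Finset.sum_le_sum fun i _ => key i).trans_eq ?_
  simp only [Finset.sum_const, Finset.card_univ, Fintype.card_fin, nsmul_eq_mul]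

/-! ### The relaxed optimum of the two networks -/

namespace Network

theorem Cdet_eq {N : ℕ} {W : Network N} {v : ℕ}
    (hle : ∀ x, W.RelaxedFeasible x → ∑ i, ∑ j, x i j ≤ v)
    (hex : ∃ x, W.RelaxedFeasible x ∧ ∑ i, ∑ j, x i j = v) : W.Cdet = v := by
  refine IsGreatest.csSup_eq ⟨?_, ?_⟩
  · obtain ⟨x, hx, h⟩ := hex
    exact ⟨x, hx, h.symm⟩
  · rintro _ ⟨x, hx, rfl⟩
    exact hle x hx

theorem Cdet_ofOwner_half {N M : ℕ} (owner : Fin M → Fin N) {l : ℕ} {p : unitInterval}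
    (hp : (p : ℝ) = 1 / 2) (hM : 0 < M) (hτ : 0 < 2 * l)
    (hl : ∀ i, (Finset.univ.filter fun j => owner j = i).card ≤ l) :
    (ofOwner owner (2 * l) p hM hτ).Cdet = M := by
  refine Cdet_eq (fun x hx => sum_le_of_relaxedFeasible hx)
    ⟨fun i (j : Fin M) => if owner j = i then 1 else 0, ⟨?_, ?_, ?_⟩, ?_⟩
  · intro i j
    by_cases h : owner j = i <;> simp [h]
  · intro i
    -- Owned packets have size `2`, so `l` of them fit in `2 * l`; the others contribute `0 / 0 =
    -- 0`.
    have h1 (j : Fin M) : ((if owner j = i then 1 else 0 : ℕ) : ℝ≥0∞) /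
        ENNReal.ofReal ((if owner j = i then p else 0 : unitInterval) : ℝ) =
        if owner j = i then 2 else 0 := by
      split_ifs
      · rw [hp, one_div, ENNReal.ofReal_inv_of_pos (by norm_num)]
        simp
      · simp
    calc _ = ∑ j : Fin M, if owner j = i then (2 : ℝ≥0∞) else 0 :=
          Finset.sum_congr rfl fun j _ => h1 j
      _ = ((Finset.univ.filter fun j => owner j = i).card * 2 : ℕ) := by
          rw [← Finset.sum_filter, Finset.sum_const, nsmul_eq_mul]
          push_cast
          rfl
      _ ≤ ((2 * l : ℕ) : ℝ≥0∞) := by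
          have := hl i
          exact_mod_cast (by omega : _ * 2 ≤ 2 * l)
  · intro j
    simp
  · rw [Finset.sum_comm]
    simp only [Finset.sum_ite_eq, Finset.mem_univ, if_true, Finset.sum_const, smul_eq_mul, mul_one]
    exact Finset.card_fin M

theorem Cdet_ofOwner_eq_zero {N M : ℕ} (owner : Fin M → Fin N) {p : unitInterval}
    (hp : (p : ℝ) < 1) (hM : 0 < M) :
    (ofOwner owner 1 p hM one_pos).Cdet = 0 := by
  refine Cdet_eq (fun x hx => ?_) ⟨0, ⟨?_, ?_, ?_⟩, ?_⟩
  · refine (Finset.sum_eq_zero fun i _ => Finset.sum_eq_zero fun j _ => ?_).le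
    refine (hx.zero_or_one i j).resolve_right fun h1 => ?_
    have h2 := (Finset.single_le_sum (fun j _ => zero_le) (Finset.mem_univ j)).trans
      (hx.capacity i)
    have h3 : ((ofOwner owner 1 p hM one_pos).p i j : ℝ) < 1 := by
      simp only [ofOwner]
      split_ifs
      exacts [hp, by simp]
    rw [h1, Nat.cast_one, one_div, show (ofOwner owner 1 p hM one_pos).τ = 1 from rfl,
      Nat.cast_one, ENNReal.inv_le_one, ENNReal.one_le_ofReal] at h2
    linarith
  all_goals simp

end Network

/-! ### Attaining the bound with one client per access point -/

/-- With client `i` assigned to access point `i`, every access point transmits the packet of its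
own client until it is delivered. -/
noncomputable def Policy.diagonal (N : ℕ) : Policy N N where
  assign _ j := j
  transmit _ cur i := by
    classical exact if cur.assignment i = i ∧ ¬ cur.Delivered i then some i else none
  transmit_mem_buffer past cur i j h := by
    split_ifs at h with h1
    cases Option.some.inj h
    exact h1

theorem Policy.deliveries_diagonal {N : ℕ} (ω : ℕ → Fin N → Fin N → Bool) (k : ℕ) (j : Fin N) :
    (Policy.diagonal N).deliveries 1 ω k j = if ω k j j then 1 else 0 := by
  have h1 : (Policy.diagonal N).deliveries 1 ω k j = 1 ↔ ω k j j = true := by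
    have h2 (i : Fin N) : (Policy.diagonal N).transmission 1 k ω i = some i := by
      simp [Policy.transmission, Nat.mod_one, Policy.runInterval, Policy.diagonal,
        IntervalRecord.Delivered]
    rw [Policy.deliveries_eq_one_iff]
    simp [h2]
  rcases Policy.deliveries_zero_or_one (Policy.diagonal N) 1 ω k j with h | h
  · simp_all
  · simp_all

theorem Policy.sum_deliveries_diagonal {N : ℕ} (ω : ℕ → Fin N → Fin N → Bool) (k : ℕ) :
    ∑ j, ((Policy.diagonal N).deliveries 1 ω k j : ℝ) =
      cappedCount 1 fun (t : Fin 1) i => ω (k * 1 + t) i i := by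
  refine Finset.sum_congr rfl fun j _ => ?_
  rw [Policy.deliveries_diagonal]
  simp only [Finset.univ_unique, Finset.sum_singleton]
  by_cases h : ω k j j <;> simp [h]

/-- In one-slot intervals the buffer is never empty and the cap `1` never binds, so
`Policy.diagonal` meets the upper bound on every path, with equality in each interval. -/
theorem Network.CT3_diagonal {N : ℕ} (hN : 0 < N) (p : unitInterval) :
    (Network.ofOwner (id : Fin N → Fin N) 1 p hN one_pos).CT3 = N * p := by
  have hl (i : Fin N) : (Finset.univ.filter fun j => id j = i).card ≤ 1 := by
    rw [Finset.card_le_one]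
    simp
  have hae := fun η => Network.ae_pathThroughput_le (id : Fin N → Fin N) 1 p hN one_pos hl
    Function.surjective_id η
  rw [← expectedCappedCount_one_one]
  refine le_antisymm (Network.CT3_le_expectedCappedCount _ _ _ _ _ hl Function.surjective_id) ?_
  refine Network.le_CT3 (expectedCappedCount_nonneg N 1 1 p) hae (Policy.diagonal N) ?_
  filter_upwards [Network.ae_tendsto_average_selected (id : Fin N → Fin N) 1 p hN one_pos
    (fun _ _ i => i) (fun _ _ _ _ => rfl) (fun _ _ _ => rfl) 1] with ω hω
  rw [← hω.limsup_eq]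
  refine le_of_eq ?_
  unfold Network.pathThroughput
  congr 1
  funext r
  congr 1
  refine Finset.sum_congr rfl fun k _ => ?_
  exact (Policy.sum_deliveries_diagonal ω k).symm

/-! ### Choice of parameters -/

theorem mainTheorem8 :
    (∀ N : ℕ, 1 ≤ N → ∀ ε : ℝ, 0 < ε → ε < N →
      ∃ W : Network N, W.CT3 - (W.Cdet : ℝ) = N - ε) ∧
    (∃ k : ℝ, 0 < k ∧ ∀ N : ℕ, 1 ≤ N → ∀ l : ℕ, 1 ≤ l →
      ∃ W : Network N, W.Cdet = N * l ∧
        (W.Cdet : ℝ) - W.CT3 > k * Real.sqrt ((N : ℝ) * (W.Cdet : ℝ))) := by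
  constructor
  · intro N hN ε hε hεN
    have hN0 : (0 : ℝ) < N := by exact_mod_cast hN
    have h1 : ε / N < 1 := (div_lt_one hN0).2 hεN
    have h2 : 0 < ε / N := by positivity
    -- Chosen so that `N * p = N - ε`.
    let p : unitInterval := ⟨1 - ε / N, by linarith, by linarith⟩
    refine ⟨Network.ofOwner id 1 p hN one_pos, ?_⟩
    rw [Network.CT3_diagonal, Network.Cdet_ofOwner_eq_zero _ (by simp only [p]; linarith)]
    simp only [p, Nat.cast_zero, sub_zero]
    field_simp
  -- Any positive constant below `5 / 32` would do, since `√(N * (N * l)) = N * √l`.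
  · refine ⟨1 / 8, by norm_num, fun N hN l hl => ?_⟩
    let p : unitInterval := ⟨1 / 2, by norm_num, by norm_num⟩
    let owner : Fin (N * l) → Fin N := fun j => (finProdFinEquiv.symm j).1
    have hM : 0 < N * l := Nat.mul_pos hN hl
    have hfib (i : Fin N) : (Finset.univ.filter fun j => owner j = i).card ≤ l := by
      have h1 := Finset.card_le_card_of_injOn (t := Finset.univ)
        (s := Finset.univ.filter fun j => owner j = i)
        (fun j => (finProdFinEquiv.symm j).2) (fun _ _ => by simp) (fun j hj j' hj' h => by
          simp only [Finset.coe_filter, Finset.mem_univ, true_and, Set.mem_ofPred_eq] at hj hj'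
          exact finProdFinEquiv.symm.injective (Prod.ext (hj.trans hj'.symm) h))
      simpa using h1
    have hsurj : Function.Surjective owner := fun i =>
      ⟨finProdFinEquiv (i, ⟨0, hl⟩), by simp only [owner, Equiv.symm_apply_apply]⟩
    have hdet := Network.Cdet_ofOwner_half owner (p := p) rfl hM (by omega) hfib
    refine ⟨Network.ofOwner owner (2 * l) p hM (by omega), hdet, ?_⟩
    rw [hdet]
    have h1 := (Network.CT3_le_expectedCappedCount owner (2 * l) p hM (by omega) hfib
      hsurj).trans (expectedCappedCount_half_le N l hl rfl)
    have h2 : Real.sqrt ((N : ℝ) * ((N * l : ℕ) : ℝ)) = N * Real.sqrt l := by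
      rw [Nat.cast_mul, ← mul_assoc, Real.sqrt_mul (by positivity),
        Real.sqrt_mul_self (by positivity)]
    have h3 : 0 < N * Real.sqrt l :=
      mul_pos (by exact_mod_cast hN) (Real.sqrt_pos.2 (by exact_mod_cast hl))
    rw [h2, Nat.cast_mul]
    linarith
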